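/- For a sequence $\bar p=(p(1),p(2),\dots)$ of reals with $0\le p(i)\le 1$, let $G(n,\bar p)$ be the random graph with vertex set $\{1,2,\dots,n\}$ in which each pair of distinct vertices $v,w$ is joined by an edge with probability $p(|v-w|)$, independently for each pair. Let $L$ be first-order logic (with equality) whose vocabulary consists of the binary adjacency predicate. For every infinite sequence $\bar a=(a(1),a(2),\dots)$ of reals with $0\le a(i)<1$ for all $i\ge 1$, there is a sequence of natural numbers $f(1),f(2),\dots$ such that the following holds. Let $\bar p$ be any sequence obtained from $\bar a$ by inserting, for each $i\ge 1$, more than $f(i)$ zeros (a finite number $g(i)>f(i)$) immediately after the $i$-th term of $\bar a$. Then for every sentence $\psi$ of $L$ a zero-one law holds: the probability that $G(n,\bar p)$ satisfies $\psi$ converges, as $n\to\infty$, either to $0$ or to $1$. -/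

import Mathlib

open Filter Topology

noncomputable section

/-- The weight of a graph `G` on `n` vertices under the law of `G(n, p)`: each pair `v < w` is an
edge with probability `p (w - v)`, independently of all other pairs. The vertex set `{1, …, n}` is
represented by `Fin n`, which leaves all differences `w - v` unchanged. Only the values `p d` with
`1 ≤ d < n` are used. -/
def graphWeight (p : ℕ → ℝ) (n : ℕ) (G : SimpleGraph (Fin n)) : ℝ :=
  open Classical in
  ∏ e ∈ (Finset.univ : Finset (Fin n × Fin n)) with e.1 < e.2,
    if G.Adj e.1 e.2 then p ((e.2 : ℕ) - (e.1 : ℕ)) else 1 - p ((e.2 : ℕ) - (e.1 : ℕ))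

/-- `G ⊨ ψ`, for a first-order sentence `ψ` (with equality) in the language of graphs. -/
def GraphSatisfies {V : Type} (G : SimpleGraph V) (ψ : FirstOrder.Language.graph.Sentence) :
    Prop :=
  @FirstOrder.Language.Sentence.Realize FirstOrder.Language.graph V G.structure ψ

/-- The probability that `G(n, p)` satisfies the sentence `ψ`. -/
def sentenceProb (p : ℕ → ℝ) (n : ℕ) (ψ : FirstOrder.Language.graph.Sentence) : ℝ :=
  open Classical in
  ∑ G ∈ (Finset.univ : Finset (SimpleGraph (Fin n))) with GraphSatisfies G ψ, graphWeight p n G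

/-- The zero-one law for `ψ`: its probability in `G(n, p)` tends to `0` or to `1`. -/
def ZeroOneLaw (p : ℕ → ℝ) (ψ : FirstOrder.Language.graph.Sentence) : Prop :=
  Tendsto (fun n => sentenceProb p n ψ) atTop (𝓝 0) ∨
    Tendsto (fun n => sentenceProb p n ψ) atTop (𝓝 1)

/-- The position, counted from `1`, of the `i`-th term (`i ≥ 1`) of a sequence once `g j` zeros
have been inserted after its `j`-th term, for every `j ≥ 1`. -/
def dilutedPos (g : ℕ → ℕ) (i : ℕ) : ℕ :=
  i + ∑ j ∈ Finset.Ico 1 i, g j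

/-- `p = (p 1, p 2, …)` is obtained from `a = (a 1, a 2, …)` by inserting, for every `i ≥ 1`,
exactly `g i` zeros after the `i`-th term. The values at index `0` play no role. -/
def IsDilution (a : ℕ → ℝ) (g : ℕ → ℕ) (p : ℕ → ℝ) : Prop :=
  (∀ i, 1 ≤ i → p (dilutedPos g i) = a i) ∧
    ∀ m, 1 ≤ m → (∀ i, 1 ≤ i → m ≠ dilutedPos g i) → p m = 0

end

/-!
A finite graph is called placeable if its vertices can be placed in `ℕ` so that all edges join
vertices at distances `d` with `p d ≠ 0`. Every graph of positive weight in `G(n, p)` is placeable,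
and placeable graphs are closed under disjoint sums and induced subgraphs. The proof combines two
facts about them.

*Absorption* (`Placeable.exists_absorbing`). Let `m` be the number of rounds of the
Ehrenfeucht–Fraïssé game that decides `ψ` (`exists_backForth_graphSatisfies`). Graphs have only
finitely many `m`-round types (`BackForth.finite_types`), types of disjoint sums are determined by
the types of the summands (`BackForth.sum`), and the game cannot count beyond `m` copies of a graph
(`BackForth.copies`). So the disjoint sum `H` of `m` copies of one placeable graph of each type is
`m`-equivalent to `H ⊕g K` for every placeable `K`.

*Appearance* (`exists_sum_graphWeight_no_copy_le`). Asymptotically almost surely `G(n, p)` contains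
a translate of the placed graph `H` without edges to the remaining vertices. Then `G(n, p)` is
isomorphic to `H ⊕g K` with `K` placeable, whence `G(n, p)` satisfies `ψ` exactly when `H` does,
which is the zero-one law (`zeroOneLaw_of_growth`).

For the appearance, suppose that `k` terms of `a` have positions below `n`. A translate of `H` meets
at most `|H| (2 k + 1)` pairs of nonzero probability, so it is an isolated copy with probability at
least `c ^ (|H| (2 k + 1))`, where `c > 0` depends only on `a 1, …, a k`; here `a i < 1` is needed.
The events for two translates are independent unless some pair meets both, and a greedy choice
gives about `n / (|H| ^ 2 (2 k + 1))` independent translates. If `f (k - 1)` is chosen large in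
terms of `a 1, …, a k`, then `n > f (k - 1)` makes the expected number of isolated copies among
them tend to infinity. No assumption on additive relations between the distances is needed,
since cycles that they create are themselves placeable graphs.
-/

/-! ### Back-and-forth systems of finite depth between graphs -/

/-- A position in the Ehrenfeucht–Fraïssé game on `G` and `H`, recorded as the set of pairs of
vertices chosen so far, is a partial isomorphism. -/
def IsPartialIso {V W : Type} (G : SimpleGraph V) (H : SimpleGraph W) (P : Set (V × W)) : Prop :=
  ∀ a ∈ P, ∀ b ∈ P, (a.1 = b.1 ↔ a.2 = b.2) ∧ (G.Adj a.1 b.1 ↔ H.Adj a.2 b.2)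

/-- Duplicator wins the `m`-round Ehrenfeucht–Fraïssé game on `G` and `H` from the position `P`,
the set of pairs of vertices chosen so far. -/
def BackForth {V W : Type} (G : SimpleGraph V) (H : SimpleGraph W) : ℕ → Set (V × W) → Prop
  | 0, P => IsPartialIso G H P
  | m + 1, P => IsPartialIso G H P ∧
      (∀ x, ∃ y, BackForth G H m (insert (x, y) P)) ∧
      ∀ y, ∃ x, BackForth G H m (insert (x, y) P)

namespace BackForth

variable {U V W V' W' : Type} {F : SimpleGraph U} {G : SimpleGraph V} {H : SimpleGraph W}
  {G' : SimpleGraph V'} {H' : SimpleGraph W'}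

theorem isPartialIso {m : ℕ} {P : Set (V × W)} (h : BackForth G H m P) : IsPartialIso G H P := by
  cases m with
  | zero => exact h
  | succ m => exact h.1

theorem anti {m : ℕ} {P Q : Set (V × W)} (h : BackForth G H m P) (hQ : Q ⊆ P) :
    BackForth G H m Q := by
  induction m generalizing P Q with
  | zero => exact fun a ha b hb => h a (hQ ha) b (hQ hb)
  | succ m ih =>
    refine ⟨fun a ha b hb => h.1 a (hQ ha) b (hQ hb), fun x => ?_, fun y => ?_⟩
    · obtain ⟨y, hy⟩ := h.2.1 x
      exact ⟨y, ih hy (Set.insert_subset_insert hQ)⟩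
    · obtain ⟨x, hx⟩ := h.2.2 y
      exact ⟨x, ih hx (Set.insert_subset_insert hQ)⟩

theorem of_succ {m : ℕ} {P : Set (V × W)} (h : BackForth G H (m + 1) P) : BackForth G H m P := by
  induction m generalizing P with
  | zero => exact h.1
  | succ m ih =>
    refine ⟨h.1, fun x => ?_, fun y => ?_⟩
    · obtain ⟨y, hy⟩ := h.2.1 x
      exact ⟨y, ih hy⟩
    · obtain ⟨x, hx⟩ := h.2.2 y
      exact ⟨x, ih hx⟩

theorem of_le {m m' : ℕ} (hm : m ≤ m') {P : Set (V × W)} (h : BackForth G H m' P) :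
    BackForth G H m P := by
  induction hm with
  | refl => exact h
  | step _ ih => exact ih h.of_succ

theorem trans {m : ℕ} {P : Set (U × V)} {Q : Set (V × W)} (h : BackForth F G m P)
    (h' : BackForth G H m Q) :
    BackForth F H m {a | ∃ b, (a.1, b) ∈ P ∧ (b, a.2) ∈ Q} := by
  have key : ∀ {P : Set (U × V)} {Q : Set (V × W)}, IsPartialIso F G P → IsPartialIso G H Q →
      IsPartialIso F H {a | ∃ b, (a.1, b) ∈ P ∧ (b, a.2) ∈ Q} := by
    rintro P Q h h' a ⟨x, hx, hx'⟩ b ⟨y, hy, hy'⟩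
    exact ⟨(h _ hx _ hy).1.trans (h' _ hx' _ hy').1, (h _ hx _ hy).2.trans (h' _ hx' _ hy').2⟩
  have ins : ∀ {P : Set (U × V)} {Q : Set (V × W)} (x : U) (y : V) (z : W),
      insert (x, z) {a : U × W | ∃ b, (a.1, b) ∈ P ∧ (b, a.2) ∈ Q} ⊆
        {a | ∃ b, (a.1, b) ∈ insert (x, y) P ∧ (b, a.2) ∈ insert (y, z) Q} := by
    rintro P Q x y z a (rfl | ⟨b, hb, hb'⟩)
    · exact ⟨y, Or.inl rfl, Or.inl rfl⟩
    · exact ⟨b, Or.inr hb, Or.inr hb'⟩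
  induction m generalizing P Q with
  | zero => exact key h h'
  | succ m ih =>
    refine ⟨key h.1 h'.1, fun x => ?_, fun z => ?_⟩
    · obtain ⟨y, hy⟩ := h.2.1 x
      obtain ⟨z, hz⟩ := h'.2.1 y
      exact ⟨z, (ih hy hz).anti (ins x y z)⟩
    · obtain ⟨y, hy⟩ := h'.2.2 z
      obtain ⟨x, hx⟩ := h.2.2 y
      exact ⟨x, (ih hx hy).anti (ins x y z)⟩

theorem of_iso (φ : G ≃g H) (m : ℕ) {P : Set (V × W)} (hP : ∀ a ∈ P, φ a.1 = a.2) :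
    BackForth G H m P := by
  have key : ∀ {P : Set (V × W)}, (∀ a ∈ P, φ a.1 = a.2) → IsPartialIso G H P := by
    intro P hP a ha b hb
    rw [← hP a ha, ← hP b hb]
    exact ⟨φ.injective.eq_iff.symm, φ.map_adj_iff.symm⟩
  induction m generalizing P with
  | zero => exact key hP
  | succ m ih =>
    refine ⟨key hP, fun x => ⟨φ x, ih ?_⟩, fun y => ⟨φ.symm y, ih ?_⟩⟩
    · rintro a (rfl | ha)
      exacts [rfl, hP a ha]
    · rintro a (rfl | ha)
      exacts [φ.apply_symm_apply y, hP a ha]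

/-- Winning strategies on two pairs of graphs combine to one on their disjoint sums. -/
theorem sum {m : ℕ} {P : Set (V × W)} {Q : Set (V' × W')} (h : BackForth G H m P)
    (h' : BackForth G' H' m Q) :
    BackForth (G ⊕g G') (H ⊕g H') m
      (Prod.map Sum.inl Sum.inl '' P ∪ Prod.map Sum.inr Sum.inr '' Q) := by
  have key : ∀ {P : Set (V × W)} {Q : Set (V' × W')}, IsPartialIso G H P → IsPartialIso G' H' Q →
      IsPartialIso (G ⊕g G') (H ⊕g H')
        (Prod.map Sum.inl Sum.inl '' P ∪ Prod.map Sum.inr Sum.inr '' Q) := by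
    rintro P Q h h' _ (⟨a, ha, rfl⟩ | ⟨a, ha, rfl⟩) _ (⟨b, hb, rfl⟩ | ⟨b, hb, rfl⟩)
    · simpa using h a ha b hb
    · simp
    · simp
    · simpa using h' a ha b hb
  induction m generalizing P Q with
  | zero => exact key h h'
  | succ m ih =>
    have insl : ∀ x y, BackForth G H m (insert (x, y) P) → BackForth (G ⊕g G') (H ⊕g H') m
        (insert (Sum.inl x, Sum.inl y)
          (Prod.map Sum.inl Sum.inl '' P ∪ Prod.map Sum.inr Sum.inr '' Q)) := by
      intro x y hxy
      refine (ih hxy h'.of_succ).anti (le_of_eq ?_)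
      rw [Set.image_insert_eq, Set.insert_union]
      rfl
    have insr : ∀ x y, BackForth G' H' m (insert (x, y) Q) → BackForth (G ⊕g G') (H ⊕g H') m
        (insert (Sum.inr x, Sum.inr y)
          (Prod.map Sum.inl Sum.inl '' P ∪ Prod.map Sum.inr Sum.inr '' Q)) := by
      intro x y hxy
      refine (ih h.of_succ hxy).anti (le_of_eq ?_)
      rw [Set.image_insert_eq, Set.union_insert]
      rfl
    refine ⟨key h.1 h'.1, ?_, ?_⟩
    · rintro (x | x)
      · obtain ⟨y, hy⟩ := h.2.1 x
        exact ⟨_, insl x y hy⟩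
      · obtain ⟨y, hy⟩ := h'.2.1 x
        exact ⟨_, insr x y hy⟩
    · rintro (y | y)
      · obtain ⟨x, hx⟩ := h.2.2 y
        exact ⟨_, insl x y hx⟩
      · obtain ⟨x, hx⟩ := h'.2.2 y
        exact ⟨_, insr x y hx⟩

/-- Duplicator's strategy for two powers `ι × G` and `κ × G` (disjoint unions of copies of `G`):
`σ` matches copies on both sides, and every matched pair of vertices sits at the same place of
matched copies. A fresh copy on one side is answered by a fresh copy on the other. -/
theorem copies_aux {ι κ : Type} [Fintype ι] [Fintype κ] (m : ℕ) (σ : Finset (ι × κ))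
    (hσ : ∀ a ∈ σ, ∀ b ∈ σ, a.1 = b.1 ↔ a.2 = b.2)
    (hι : σ.card + m ≤ Fintype.card ι) (hκ : σ.card + m ≤ Fintype.card κ) :
    BackForth ((⊥ : SimpleGraph ι) □ G) ((⊥ : SimpleGraph κ) □ G) m
      {a | (a.1.1, a.2.1) ∈ σ ∧ a.1.2 = a.2.2} := by
  classical
  have key : ∀ σ : Finset (ι × κ), (∀ a ∈ σ, ∀ b ∈ σ, a.1 = b.1 ↔ a.2 = b.2) →
      IsPartialIso ((⊥ : SimpleGraph ι) □ G) ((⊥ : SimpleGraph κ) □ G)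
        {a | (a.1.1, a.2.1) ∈ σ ∧ a.1.2 = a.2.2} := by
    rintro σ hσ ⟨⟨i, x⟩, ⟨j, y⟩⟩ ⟨ha, hxy⟩ ⟨⟨i', x'⟩, ⟨j', y'⟩⟩ ⟨hb, hxy'⟩
    have := hσ _ ha _ hb
    simp only at hxy hxy' this
    subst hxy hxy'
    simp [SimpleGraph.boxProd_adj, this]
  induction m generalizing σ with
  | zero => exact key σ hσ
  | succ m ih =>
    -- One more round, in which the copies `i` and `j`, already matched or both fresh, are used.
    have step : ∀ i j x, ((i, j) ∈ σ ∨ (i ∉ σ.image Prod.fst ∧ j ∉ σ.image Prod.snd)) →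
        BackForth ((⊥ : SimpleGraph ι) □ G) ((⊥ : SimpleGraph κ) □ G) m
          (insert ((i, x), (j, x)) {a | (a.1.1, a.2.1) ∈ σ ∧ a.1.2 = a.2.2}) := by
      intro i j x hij
      have hcard : (insert (i, j) σ).card ≤ σ.card + 1 := Finset.card_insert_le _ _
      refine (ih (insert (i, j) σ) ?_ (by omega) (by omega)).anti ?_
      · rcases hij with hij | ⟨hi, hj⟩
        · rwa [Finset.insert_eq_of_mem hij]
        · intro a ha b hb
          rw [Finset.mem_insert] at ha hb
          rcases ha with rfl | ha <;> rcases hb with rfl | hb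
          · simp
          · exact iff_of_false (fun h => hi (Finset.mem_image.2 ⟨b, hb, h.symm⟩))
              (fun h => hj (Finset.mem_image.2 ⟨b, hb, h.symm⟩))
          · exact iff_of_false (fun h => hi (Finset.mem_image.2 ⟨a, ha, h⟩))
              (fun h => hj (Finset.mem_image.2 ⟨a, ha, h⟩))
          · exact hσ a ha b hb
      · rintro a (rfl | ⟨ha, ha'⟩)
        · exact ⟨Finset.mem_insert_self _ _, rfl⟩
        · exact ⟨Finset.mem_insert_of_mem ha, ha'⟩
    have fresh : ∀ {α : Type} [Fintype α] (s : Finset α), s.card < Fintype.card α → ∃ a, a ∉ s :=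
      fun s hs => by
        by_contra! h
        rw [Finset.eq_univ_iff_forall.2 h, Finset.card_univ] at hs
        exact lt_irrefl _ hs
    have hfst : (σ.image Prod.fst).card ≤ σ.card := Finset.card_image_le
    have hsnd : (σ.image Prod.snd).card ≤ σ.card := Finset.card_image_le
    refine ⟨key σ hσ, ?_, ?_⟩
    · rintro ⟨i, x⟩
      by_cases hi : i ∈ σ.image Prod.fst
      · obtain ⟨⟨i, j⟩, h, rfl⟩ := Finset.mem_image.1 hi
        exact ⟨(j, x), step i j x (Or.inl h)⟩
      · obtain ⟨j, hj⟩ := fresh (σ.image Prod.snd) (by omega)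
        exact ⟨(j, x), step i j x (Or.inr ⟨hi, hj⟩)⟩
    · rintro ⟨j, x⟩
      by_cases hj : j ∈ σ.image Prod.snd
      · obtain ⟨⟨i, j⟩, h, rfl⟩ := Finset.mem_image.1 hj
        exact ⟨(i, x), step i j x (Or.inl h)⟩
      · obtain ⟨i, hi⟩ := fresh (σ.image Prod.fst) (by omega)
        exact ⟨(i, x), step i j x (Or.inr ⟨hi, hj⟩)⟩

theorem copies {ι κ : Type} [Fintype ι] [Fintype κ] (m : ℕ)
    (hι : m ≤ Fintype.card ι) (hκ : m ≤ Fintype.card κ) :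
    BackForth ((⊥ : SimpleGraph ι) □ G) ((⊥ : SimpleGraph κ) □ G) m ∅ :=
  (copies_aux m ∅ (by simp) (by simpa using hι) (by simpa using hκ)).anti (Set.empty_subset _)

/-- There are only finitely many `m`-round types of `k`-tuples of vertices of graphs. -/
theorem finite_types (m k : ℕ) :
    ∃ (T : Type) (_ : Finite T) (tp : ∀ V : Type, SimpleGraph V → (Fin k → V) → T),
      ∀ (V W : Type) (G : SimpleGraph V) (H : SimpleGraph W) (v : Fin k → V) (w : Fin k → W),
        tp V G v = tp W H w → BackForth G H m (Set.range fun i => (v i, w i)) := by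
  have atomic : ∀ k : ℕ, ∃ (T : Type) (_ : Finite T)
      (tp : ∀ V : Type, SimpleGraph V → (Fin k → V) → T),
      ∀ (V W : Type) (G : SimpleGraph V) (H : SimpleGraph W) (v : Fin k → V) (w : Fin k → W),
        tp V G v = tp W H w → IsPartialIso G H (Set.range fun i => (v i, w i)) := by
    intro k
    refine ⟨Fin k → Fin k → Prop × Prop, inferInstance,
      fun V G v i j => (v i = v j, G.Adj (v i) (v j)), ?_⟩
    rintro V W G H v w h _ ⟨i, rfl⟩ _ ⟨j, rfl⟩
    have := congrFun (congrFun h i) j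
    simpa using this
  induction m generalizing k with
  | zero => exact atomic k
  | succ m ih =>
    obtain ⟨T₀, _, tp₀, h₀⟩ := atomic k
    obtain ⟨T, _, tp, h⟩ := ih (k + 1)
    refine ⟨T₀ × Set T, inferInstance,
      fun V G v => (tp₀ V G v, Set.range fun x => tp V G (Fin.snoc v x)), ?_⟩
    intro V W G H v w hvw
    have e₀ : tp₀ V G v = tp₀ W H w := congrArg Prod.fst hvw
    have e : (Set.range fun x => tp V G (Fin.snoc v x)) =
        Set.range fun y => tp W H (Fin.snoc w y) := congrArg Prod.snd hvw
    have ext : ∀ x y, tp V G (Fin.snoc v x) = tp W H (Fin.snoc w y) →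
        BackForth G H m (insert (x, y) (Set.range fun i => (v i, w i))) := by
      intro x y hxy
      refine (h V W G H _ _ hxy).anti ?_
      rintro _ (rfl | ⟨i, rfl⟩)
      · exact ⟨Fin.last k, by simp⟩
      · exact ⟨i.castSucc, by simp⟩
    refine ⟨h₀ V W G H v w e₀, fun x => ?_, fun y => ?_⟩
    · have : tp V G (Fin.snoc v x) ∈ Set.range fun y => tp W H (Fin.snoc w y) :=
        e ▸ Set.mem_range_self x
      obtain ⟨y, hy⟩ := this
      exact ⟨y, ext x y hy.symm⟩
    · have : tp W H (Fin.snoc w y) ∈ Set.range fun x => tp V G (Fin.snoc v x) :=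
        e.symm ▸ Set.mem_range_self y
      obtain ⟨x, hx⟩ := this
      exact ⟨x, ext x y hx⟩

end BackForth

/-- A first-order formula cannot tell apart tuples for which Duplicator wins a long enough game. -/
theorem exists_backForth_realize {k : ℕ}
    (φ : FirstOrder.Language.graph.BoundedFormula Empty k) :
    ∃ m, ∀ (V W : Type) (G : SimpleGraph V) (H : SimpleGraph W) (v : Fin k → V) (w : Fin k → W),
      BackForth G H m (Set.range fun i => (v i, w i)) →
        (@FirstOrder.Language.BoundedFormula.Realize _ V G.structure _ _ φ Empty.elim v ↔
          @FirstOrder.Language.BoundedFormula.Realize _ W H.structure _ _ φ Empty.elim w) := by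
  have term : ∀ {k : ℕ} (t : FirstOrder.Language.graph.Term (Empty ⊕ Fin k)),
      ∃ i : Fin k, t = FirstOrder.Language.Term.var (Sum.inr i) := by
    intro k t
    cases t with
    | var x =>
      rcases x with x | i
      · exact x.elim
      · exact ⟨i, rfl⟩
    | func f => exact f.elim
  induction φ with
  | falsum => exact ⟨0, fun _ _ _ _ _ _ _ => Iff.rfl⟩
  | equal t₁ t₂ =>
    obtain ⟨i, rfl⟩ := term t₁
    obtain ⟨j, rfl⟩ := term t₂
    exact ⟨0, fun V W G H v w h => (h _ ⟨i, rfl⟩ _ ⟨j, rfl⟩).1⟩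
  | rel R ts =>
    cases R
    obtain ⟨i, hi⟩ := term (ts 0)
    obtain ⟨j, hj⟩ := term (ts 1)
    refine ⟨0, fun V W G H v w h => ?_⟩
    have := (h _ ⟨i, rfl⟩ _ ⟨j, rfl⟩).2
    simp only [FirstOrder.Language.BoundedFormula.Realize]
    change G.Adj _ _ ↔ H.Adj _ _
    simpa [hi, hj] using this
  | imp f₁ f₂ ih₁ ih₂ =>
    obtain ⟨m₁, h₁⟩ := ih₁
    obtain ⟨m₂, h₂⟩ := ih₂
    refine ⟨max m₁ m₂, fun V W G H v w h => ?_⟩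
    exact imp_congr (h₁ V W G H v w (h.of_le (le_max_left _ _)))
      (h₂ V W G H v w (h.of_le (le_max_right _ _)))
  | @all k f ih =>
    obtain ⟨m, hm⟩ := ih
    refine ⟨m + 1, fun V W G H v w h => ?_⟩
    have ext : ∀ x y, BackForth G H m (insert (x, y) (Set.range fun i => (v i, w i))) →
        BackForth G H m (Set.range fun i => ((Fin.snoc v x : Fin (k + 1) → V) i,
          (Fin.snoc w y : Fin (k + 1) → W) i)) := by
      intro x y hxy
      refine hxy.anti ?_
      rintro _ ⟨i, rfl⟩
      refine Fin.lastCases ?_ (fun i => ?_) i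
      · simp
      · exact Or.inr ⟨i, by simp⟩
    constructor
    · intro hv y
      obtain ⟨x, hx⟩ := h.2.2 y
      exact (hm V W G H _ _ (ext x y hx)).1 (hv x)
    · intro hw x
      obtain ⟨y, hy⟩ := h.2.1 x
      exact (hm V W G H _ _ (ext x y hy)).2 (hw y)

theorem exists_backForth_graphSatisfies (ψ : FirstOrder.Language.graph.Sentence) :
    ∃ m, ∀ (V W : Type) (G : SimpleGraph V) (H : SimpleGraph W),
      BackForth G H m ∅ → (GraphSatisfies G ψ ↔ GraphSatisfies H ψ) := by
  obtain ⟨m, hm⟩ := exists_backForth_realize ψ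
  refine ⟨m, fun V W G H h => ?_⟩
  have := hm V W G H default default (h.anti (by simp))
  unfold GraphSatisfies FirstOrder.Language.Sentence.Realize FirstOrder.Language.Formula.Realize
  convert this using 2

/-! ### Graphs realizable in `G(n, p)` and absorbing graphs -/

/-- The graph `G` can be placed in `ℕ` by `e` with every edge at a distance `d` for which
`p d ≠ 0`. -/
structure IsPlacement {V : Type} (p : ℕ → ℝ) (G : SimpleGraph V) (e : V → ℕ) : Prop where
  inj : Function.Injective e
  ne_zero : ∀ x y, G.Adj x y → e x < e y → p (e y - e x) ≠ 0

/-- A finite graph that is realizable in `G(n, p)` for some `n`: it is isomorphic to a graph with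
vertices in `ℕ` whose edges join vertices at distances `d` with `p d ≠ 0`. -/
def Placeable {V : Type} (p : ℕ → ℝ) (G : SimpleGraph V) : Prop :=
  Finite V ∧ ∃ e, IsPlacement p G e

namespace Placeable

variable {V W : Type} {p : ℕ → ℝ} {G : SimpleGraph V} {H : SimpleGraph W}

theorem exists_bound [Finite V] (e : V → ℕ) : ∃ B, ∀ x, e x < B := by
  obtain ⟨B, hB⟩ := (Set.finite_range e).bddAbove
  exact ⟨B + 1, fun x => Nat.lt_succ_of_le (hB ⟨x, rfl⟩)⟩

theorem sum (hG : Placeable p G) (hH : Placeable p H) : Placeable p (G ⊕g H) := by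
  obtain ⟨_, e, he⟩ := hG
  obtain ⟨_, e', he'⟩ := hH
  obtain ⟨B, hB⟩ := exists_bound e
  refine ⟨inferInstance, Sum.elim e (fun y => B + e' y), ?_, ?_⟩
  · refine he.inj.sumElim (fun x y h => he'.inj (by omega)) (fun x y => ?_)
    have := hB x
    omega
  · rintro (x | x) (y | y) h hlt
    · exact he.ne_zero x y (by simpa using h) hlt
    · simp at h
    · simp at h
    · have h1 := he'.ne_zero x y (by simpa using h) (by simpa using hlt)
      simpa [Nat.add_sub_add_left] using h1

theorem copies (hG : Placeable p G) (m : ℕ) : Placeable p ((⊥ : SimpleGraph (Fin m)) □ G) := by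
  obtain ⟨_, e, he⟩ := hG
  obtain ⟨B, hB⟩ := exists_bound e
  refine ⟨inferInstance, fun a => e a.2 + B * a.1, ?_, ?_⟩
  · rintro ⟨i, x⟩ ⟨j, y⟩ h
    simp only at h
    have hx := hB x
    have hy := hB y
    have hmod := congrArg (· % B) h
    have hdiv := congrArg (· / B) h
    simp only [Nat.add_mul_mod_self_left, Nat.mod_eq_of_lt hx, Nat.mod_eq_of_lt hy] at hmod
    simp only [Nat.add_mul_div_left _ _ (Nat.zero_lt_of_lt hx), Nat.div_eq_of_lt hx,
      Nat.div_eq_of_lt hy, zero_add] at hdiv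
    rw [he.inj hmod, Fin.ext hdiv]
  · rintro ⟨i, x⟩ ⟨j, y⟩ h hlt
    simp only [SimpleGraph.boxProd_adj, SimpleGraph.bot_adj, false_and, false_or] at h
    obtain ⟨h, rfl⟩ := h
    simp only [add_lt_add_iff_right, Nat.add_sub_add_right] at hlt ⊢
    exact he.ne_zero x y h hlt

theorem of_isEmpty [IsEmpty V] : Placeable p G :=
  ⟨inferInstance, fun _ => 0, Function.injective_of_subsingleton _, fun x => isEmptyElim x⟩

/-- One more copy of `G` added to `m` copies is not noticed in the `m`-round game. -/
theorem backForth_copies_sum (G : SimpleGraph V) (m : ℕ) :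
    BackForth (((⊥ : SimpleGraph (Fin m)) □ G) ⊕g G) ((⊥ : SimpleGraph (Fin m)) □ G) m ∅ := by
  -- `m` copies and one more are `Option (Fin m) × G`.
  let φ : ((⊥ : SimpleGraph (Fin m)) □ G) ⊕g G ≃g (⊥ : SimpleGraph (Option (Fin m))) □ G :=
    { toFun := Sum.elim (fun a => (some a.1, a.2)) (fun x => (none, x))
      invFun := fun a => a.1.elim (Sum.inr a.2) (fun i => Sum.inl (i, a.2))
      left_inv := by rintro (⟨i, x⟩ | x) <;> rfl
      right_inv := by rintro ⟨_ | i, x⟩ <;> rfl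
      map_rel_iff' := by
        rintro (⟨i, x⟩ | x) (⟨j, y⟩ | y) <;> simp [SimpleGraph.boxProd_adj] }
  have h := (BackForth.of_iso φ m (P := ∅) (by simp)).trans
    (BackForth.copies (ι := Option (Fin m)) (κ := Fin m) (G := G) m (by simp) (by simp))
  exact h.anti (Set.empty_subset _)

/-- The absorption principle: for every `m` some realizable graph `H` is so rich that the `m`-round
game does not notice the addition of any further realizable graph to it. It consists of `m` copies
of one graph of each of the finitely many `m`-round types. -/
theorem exists_absorbing (p : ℕ → ℝ) (m : ℕ) :
    ∃ (V : Type) (H : SimpleGraph V), Placeable p H ∧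
      ∀ (W : Type) (K : SimpleGraph W), Placeable p K → BackForth (H ⊕g K) H m ∅ := by
  classical
  obtain ⟨T, _, tp, htp⟩ := BackForth.finite_types m 0
  have : Fintype T := Fintype.ofFinite T
  suffices hS : ∀ S : Finset T, ∃ (V : Type) (H : SimpleGraph V), Placeable p H ∧
      ∀ (W : Type) (K : SimpleGraph W), Placeable p K → tp W K Fin.elim0 ∈ S →
        BackForth (H ⊕g K) H m ∅ by
    obtain ⟨V, H, hH, h⟩ := hS Finset.univ
    exact ⟨V, H, hH, fun W K hK => h W K hK (Finset.mem_univ _)⟩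
  intro S
  induction S using Finset.induction_on with
  | empty => exact ⟨Empty, ⊥, of_isEmpty, by simp⟩
  | insert τ S _ ih =>
    obtain ⟨V, H, hH, h⟩ := ih
    by_cases hτ : ∃ (U : Type) (X : SimpleGraph U), Placeable p X ∧ tp U X Fin.elim0 = τ
    · obtain ⟨U, X, hX, rfl⟩ := hτ
      refine ⟨_, H ⊕g ((⊥ : SimpleGraph (Fin m)) □ X), hH.sum (hX.copies m), fun W K hK hKS => ?_⟩
      have refl : ∀ {V : Type} (G : SimpleGraph V), BackForth G G m ∅ :=
        fun G => BackForth.of_iso SimpleGraph.Iso.refl m (by simp)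
      rcases Finset.mem_insert.1 hKS with hK' | hK'
      · -- `K` has the type of `X`, and is swallowed by the copies of `X`.
        have hKX : BackForth K X m ∅ := (htp _ _ K X _ _ hK').anti (by simp)
        have h1 := BackForth.of_iso (SimpleGraph.Iso.sumAssoc (G := H)
          (H := (⊥ : SimpleGraph (Fin m)) □ X) (I := K)) m (P := ∅) (by simp)
        have h2 := (refl H).sum (((refl ((⊥ : SimpleGraph (Fin m)) □ X)).sum hKX).anti
          (Set.empty_subset _))
        have h3 := (refl H).sum (backForth_copies_sum X m)
        exact ((h1.trans (h2.anti (Set.empty_subset _))).trans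
          (h3.anti (Set.empty_subset _))).anti (Set.empty_subset _)
      · -- `K` is swallowed by `H`.
        have h1 := BackForth.of_iso ((SimpleGraph.Iso.sumAssoc (G := H)
          (H := (⊥ : SimpleGraph (Fin m)) □ X) (I := K)).trans
            ((SimpleGraph.Iso.sumCongr SimpleGraph.Iso.refl SimpleGraph.Iso.sumComm).trans
              SimpleGraph.Iso.sumAssoc.symm)) m (P := ∅) (by simp)
        have h2 := (h W K hK hK').sum (refl ((⊥ : SimpleGraph (Fin m)) □ X))
        exact (h1.trans (h2.anti (Set.empty_subset _))).anti (Set.empty_subset _)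
    · refine ⟨V, H, hH, fun W K hK hKS => ?_⟩
      rcases Finset.mem_insert.1 hKS with hK' | hK'
      · exact absurd ⟨W, K, hK, hK'⟩ hτ
      · exact h W K hK hK'

end Placeable

/-! ### Splitting off an isolated copy -/

theorem Placeable.induce {V : Type} {p : ℕ → ℝ} {G : SimpleGraph V} (hG : Placeable p G)
    (s : Set V) : Placeable p (G.induce s) := by
  obtain ⟨_, e, he⟩ := hG
  exact ⟨inferInstance, fun x => e x, he.inj.comp Subtype.val_injective,
    fun x y h hlt => he.ne_zero x y h hlt⟩

theorem ne_zero_of_graphWeight_ne_zero {p : ℕ → ℝ} {n : ℕ} {G : SimpleGraph (Fin n)}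
    (hG : graphWeight p n G ≠ 0) {v w : Fin n} (hvw : v < w) (h : G.Adj v w) :
    p ((w : ℕ) - (v : ℕ)) ≠ 0 := by
  classical
  have := Finset.prod_ne_zero_iff.1 hG (v, w) (by simpa using hvw)
  simpa [h] using this

theorem placeable_of_graphWeight_ne_zero {p : ℕ → ℝ} {n : ℕ} {G : SimpleGraph (Fin n)}
    (hG : graphWeight p n G ≠ 0) : Placeable p G :=
  ⟨inferInstance, fun v => v, Fin.val_injective,
    fun _ _ h hlt => ne_zero_of_graphWeight_ne_zero hG hlt h⟩

/-- If `f` identifies `H` with a union of connected components of `G`, then `G` is the disjoint sum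
of `H` and the graph that `G` induces on the remaining vertices. -/
theorem nonempty_iso_sum_of_isolated {U V : Type} {G : SimpleGraph U} {H : SimpleGraph V}
    (f : V → U) (hf : Function.Injective f)
    (h : ∀ x w, G.Adj (f x) w ↔ ∃ y, w = f y ∧ H.Adj x y) :
    Nonempty (H ⊕g G.induce (Set.range f)ᶜ ≃g G) := by
  classical
  refine ⟨⟨(Equiv.sumCongr (Equiv.ofInjective f hf) (Equiv.refl _)).trans
    (Equiv.Set.sumCompl (Set.range f)), ?_⟩⟩
  rintro (x | ⟨x, hx⟩) (y | ⟨y, hy⟩)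
  · simp [h, hf.eq_iff]
  · have : ¬ G.Adj (f x) y := by
      rw [h]
      rintro ⟨z, rfl, -⟩
      exact hy ⟨z, rfl⟩
    simpa using this
  · have : ¬ G.Adj x (f y) := by
      rw [G.adj_comm, h]
      rintro ⟨z, rfl, -⟩
      exact hx ⟨z, rfl⟩
    simpa using this
  · simp

/-- The pair `v`, `w` is the image of an edge of `H` under the translate by `t` of the placement
`e`. -/
def IsCopyEdge {V : Type} (H : SimpleGraph V) (e : V → ℕ) (t v w : ℕ) : Prop :=
  ∃ x y, H.Adj x y ∧ v = e x + t ∧ w = e y + t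

/-- The translate by `t` of the placement `e` of `H` stays below `n`, and `G` agrees with it on all
pairs of nonzero probability that meet it. When `G` has positive weight this says that the translate is
an isolated copy of `H` in `G`; pairs of probability zero are left out so that only the pairs that
matter for the probability occur. -/
def IsIsolatedCopy {V : Type} (p : ℕ → ℝ) (H : SimpleGraph V) (e : V → ℕ) {n : ℕ}
    (G : SimpleGraph (Fin n)) (t : ℕ) : Prop :=
  (∀ x, e x + t < n) ∧ ∀ v w : Fin n, v < w → p ((w : ℕ) - (v : ℕ)) ≠ 0 →
    (∃ x, (v : ℕ) = e x + t ∨ (w : ℕ) = e x + t) → (G.Adj v w ↔ IsCopyEdge H e t v w)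

/-- A graph of positive weight that contains an isolated copy of the absorbing graph `H` is the
disjoint sum of this copy and a placeable graph, hence `m`-equivalent to `H`. -/
theorem backForth_of_copy {V : Type} {p : ℕ → ℝ} {H : SimpleGraph V} {e : V → ℕ}
    (he : IsPlacement p H e) {m : ℕ}
    (hH : ∀ (W : Type) (K : SimpleGraph W), Placeable p K → BackForth (H ⊕g K) H m ∅)
    {n t : ℕ} {G : SimpleGraph (Fin n)} (hG : graphWeight p n G ≠ 0)
    (hcopy : IsIsolatedCopy p H e G t) : BackForth G H m ∅ := by
  obtain ⟨ht, hcopy⟩ := hcopy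
  have all : ∀ v w : Fin n, v < w → (∃ x, (v : ℕ) = e x + t ∨ (w : ℕ) = e x + t) →
      (G.Adj v w ↔ IsCopyEdge H e t v w) := by
    intro v w hvw hx
    by_cases hp : p ((w : ℕ) - (v : ℕ)) = 0
    · refine iff_of_false (fun h => ne_zero_of_graphWeight_ne_zero hG hvw h hp) ?_
      rintro ⟨x, y, hxy, hv, hw⟩
      have hlt : e x < e y := by
        have : (v : ℕ) < w := hvw
        omega
      refine he.ne_zero x y hxy hlt ?_
      rwa [hv, hw, Nat.add_sub_add_right] at hp
    · exact hcopy v w hvw hp hx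
  let f : V → Fin n := fun x => ⟨e x + t, ht x⟩
  have hf : Function.Injective f := fun x y h => he.inj (by simpa [f] using h)
  have hadj : ∀ x w, G.Adj (f x) w ↔ ∃ y, w = f y ∧ H.Adj x y := by
    intro x w
    rcases lt_trichotomy (f x) w with hlt | rfl | hlt
    · rw [all _ _ hlt ⟨x, Or.inl rfl⟩]
      constructor
      · rintro ⟨x', y, h, hx, hy⟩
        obtain rfl : x = x' := he.inj (by simpa [f] using hx)
        exact ⟨y, Fin.ext hy, h⟩
      · rintro ⟨y, rfl, h⟩
        exact ⟨x, y, h, rfl, rfl⟩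
    · refine iff_of_false (G.irrefl) ?_
      rintro ⟨y, hy, h⟩
      exact h.ne (hf hy)
    · rw [G.adj_comm, all _ _ hlt ⟨x, Or.inr rfl⟩]
      constructor
      · rintro ⟨y, x', h, hy, hx⟩
        obtain rfl : x = x' := he.inj (by simpa [f] using hx)
        exact ⟨y, Fin.ext hy, h.symm⟩
      · rintro ⟨y, rfl, h⟩
        exact ⟨y, x, h.symm, rfl, rfl⟩
  obtain ⟨φ⟩ := nonempty_iso_sum_of_isolated f hf hadj
  exact ((BackForth.of_iso φ.symm m (P := ∅) (by simp)).trans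
    (hH _ _ ((placeable_of_graphWeight_ne_zero hG).induce _))).anti (Set.empty_subset _)

/-! ### Independence of events on disjoint sets of pairs -/

/-- For independent `Bool`-valued coordinates with laws `q i`, events prescribing the coordinates
in disjoint blocks are independent; the sum is the probability that none of them happens. -/
theorem sum_prod_avoid {I J : Type*} [Fintype I] [DecidableEq I] (q : I → Bool → ℝ)
    (hq : ∀ i, q i true + q i false = 1) (T : Finset J) (E : J → Finset I)
    (hE : (T : Set J).PairwiseDisjoint E) (pat : J → I → Bool) :
    ∑ x : I → Bool, (∏ i, q i (x i)) *
        ∏ j ∈ T, (1 - if ∀ i ∈ E j, x i = pat j i then (1 : ℝ) else 0) =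
      ∏ j ∈ T, (1 - ∏ i ∈ E j, q i (pat j i)) := by
  classical
  -- Both sides are expanded over the sets `S` of events, by inclusion and exclusion.
  simp_rw [sub_eq_add_neg, Finset.prod_one_add, Finset.mul_sum]
  rw [Finset.sum_comm]
  refine Finset.sum_congr rfl fun S hS => ?_
  have hST := Finset.mem_powerset.1 hS
  simp_rw [Finset.prod_neg, mul_left_comm _ ((-1 : ℝ) ^ _), ← Finset.mul_sum]
  congr 1
  have ind : ∀ (x : I → Bool) (j : J), (if ∀ i ∈ E j, x i = pat j i then (1 : ℝ) else 0) =
      ∏ i, if i ∈ E j then (if x i = pat j i then 1 else 0) else 1 := by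
    intro x j
    rw [Finset.prod_ite_mem, Finset.univ_inter, Finset.prod_boole]
    split_ifs <;> rfl
  simp_rw [ind, Finset.prod_comm (s := S), ← Finset.prod_mul_distrib]
  rw [← Fintype.prod_sum (fun i b => q i b * ∏ j ∈ S,
    if i ∈ E j then (if b = pat j i then (1 : ℝ) else 0) else 1)]
  have rhs : ∀ j, ∏ i ∈ E j, q i (pat j i) = ∏ i, if i ∈ E j then q i (pat j i) else 1 := by
    intro j
    rw [Finset.prod_ite_mem, Finset.univ_inter]
  simp_rw [rhs, Finset.prod_comm (s := S)]
  refine Finset.prod_congr rfl fun i _ => ?_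
  by_cases h : ∃ j ∈ S, i ∈ E j
  · obtain ⟨j, hj, hij⟩ := h
    have uniq : ∀ j' ∈ S, j' ≠ j → i ∉ E j' := fun j' hj' hne hi =>
      Finset.disjoint_left.1 (hE (hST hj') (hST hj) hne) hi hij
    have single : ∀ (u : J → ℝ), ∏ j' ∈ S, (if i ∈ E j' then u j' else 1) = u j := by
      intro u
      rw [Finset.prod_eq_single_of_mem j hj (fun j' hj' hne => if_neg (uniq j' hj' hne)),
        if_pos hij]
    simp_rw [single]
    simp
  · push Not at h
    have one : ∀ (u : J → ℝ), ∏ j' ∈ S, (if i ∈ E j' then u j' else 1) = 1 :=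
      fun u => Finset.prod_eq_one fun j hj => if_neg (h j hj)
    simp_rw [one]
    simpa using hq i

/-- The pairs `v < w` of vertices of `G(n, p)`. -/
abbrev VertexPair (n : ℕ) : Type := {e : Fin n × Fin n // e.1 < e.2}

/-- The distance of the two vertices of a pair. -/
def VertexPair.dist {n : ℕ} (i : VertexPair n) : ℕ := (i.1.2 : ℕ) - (i.1.1 : ℕ)

/-- The probability in `G(n, p)` that the pair `i` is an edge, or that it is not one. -/
def pairProb (p : ℕ → ℝ) {n : ℕ} (i : VertexPair n) (b : Bool) : ℝ :=
  if b then p i.dist else 1 - p i.dist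

open Classical in
/-- The indicator function of the edge set of a graph on `Fin n`. -/
noncomputable def edgeIndicator {n : ℕ} (G : SimpleGraph (Fin n)) (i : VertexPair n) : Bool :=
  decide (G.Adj i.1.1 i.1.2)

theorem edgeIndicator_bijective (n : ℕ) :
    Function.Bijective (edgeIndicator : SimpleGraph (Fin n) → VertexPair n → Bool) := by
  constructor
  · intro G H h
    have key : ∀ v w, v < w → (G.Adj v w ↔ H.Adj v w) := fun v w hvw => by
      simpa [edgeIndicator] using congrFun h ⟨(v, w), hvw⟩
    ext v w
    rcases lt_trichotomy v w with hlt | rfl | hlt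
    · exact key v w hlt
    · simp
    · rw [G.adj_comm, H.adj_comm, key w v hlt]
  · intro x
    refine ⟨SimpleGraph.fromRel fun v w => ∃ h : v < w, x ⟨(v, w), h⟩ = true, ?_⟩
    funext ⟨⟨v, w⟩, h⟩
    have h' : ¬ w < v := not_lt.2 (le_of_lt h)
    have hlt : v < w := h
    cases hx : x ⟨(v, w), h⟩ <;> simp [edgeIndicator, hlt, h', hlt.ne, hx]

theorem graphWeight_eq_prod (p : ℕ → ℝ) (n : ℕ) (G : SimpleGraph (Fin n)) :
    graphWeight p n G = ∏ i : VertexPair n, pairProb p i (edgeIndicator G i) := by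
  classical
  unfold graphWeight
  rw [← Finset.prod_subtype_eq_prod_filter, Finset.subtype_univ]
  refine Finset.prod_congr rfl fun i _ => ?_
  simp [pairProb, edgeIndicator, VertexPair.dist]

theorem graphWeight_nonneg {p : ℕ → ℝ} (hp : ∀ d, 1 ≤ d → 0 ≤ p d ∧ p d ≤ 1) (n : ℕ)
    (G : SimpleGraph (Fin n)) : 0 ≤ graphWeight p n G := by
  rw [graphWeight_eq_prod]
  refine Finset.prod_nonneg fun i _ => ?_
  have h : (i.1.1 : ℕ) < i.1.2 := i.2
  have := hp i.dist (by unfold VertexPair.dist; omega)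
  unfold pairProb
  split_ifs <;> linarith

open Classical in
theorem sum_graphWeight_avoid (p : ℕ → ℝ) (n : ℕ) {J : Type*} (T : Finset J)
    (E : J → Finset (VertexPair n)) (hE : (T : Set J).PairwiseDisjoint E)
    (pat : J → VertexPair n → Bool) :
    ∑ G : SimpleGraph (Fin n) with ∀ j ∈ T, ¬ ∀ i ∈ E j, edgeIndicator G i = pat j i,
        graphWeight p n G = ∏ j ∈ T, (1 - ∏ i ∈ E j, pairProb p i (pat j i)) := by
  rw [← sum_prod_avoid (pairProb p) (fun i => by simp [pairProb]) T E hE pat,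
    ← (edgeIndicator_bijective n).sum_comp, Finset.sum_filter]
  refine Finset.sum_congr rfl fun G _ => ?_
  have : ∀ j, (1 - if ∀ i ∈ E j, edgeIndicator G i = pat j i then (1 : ℝ) else 0) =
      if ¬ ∀ i ∈ E j, edgeIndicator G i = pat j i then 1 else 0 := by
    intro j
    split_ifs <;> simp
  simp_rw [this]
  rw [Finset.prod_boole, ← graphWeight_eq_prod]
  split_ifs <;> simp

theorem sum_graphWeight (p : ℕ → ℝ) (n : ℕ) : ∑ G : SimpleGraph (Fin n), graphWeight p n G = 1 := by
  have := sum_graphWeight_avoid p n (∅ : Finset ℕ) (fun _ => ∅) (by simp) (fun _ _ => true)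
  simpa using this

/-! ### Many independent chances for an isolated copy -/

/-- Greedy choice: a maximal subfamily with pairwise disjoint blocks meets every block. -/
theorem exists_maximal_pairwiseDisjoint {I J : Type*} [DecidableEq I] (R : Finset J)
    (E : J → Finset I) :
    ∃ T ⊆ R, (T : Set J).PairwiseDisjoint E ∧
      ∀ t ∈ R, t ∉ T → ∃ t' ∈ T, ¬ Disjoint (E t) (E t') := by
  classical
  obtain ⟨T, hT, hmax⟩ := (R.powerset.filter
    fun T : Finset J => (T : Set J).PairwiseDisjoint E).exists_max_image Finset.card ⟨∅, by simp⟩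
  simp only [Finset.mem_filter, Finset.mem_powerset] at hT hmax
  refine ⟨T, hT.1, hT.2, fun t ht htT => ?_⟩
  by_contra! h
  have := hmax (insert t T) ⟨Finset.insert_subset ht hT.1, by
    rw [Finset.coe_insert]
    exact hT.2.insert fun j hj _ => h j hj⟩
  rw [Finset.card_insert_of_notMem htT] at this
  omega

open Classical in
/-- The distances below `n` that occur with nonzero probability. -/
noncomputable def activeDist (p : ℕ → ℝ) (n : ℕ) : Finset ℕ :=
  (Finset.range n).filter fun d => 1 ≤ d ∧ p d ≠ 0

/-- The differences `w - v` of pairs of vertices of `G(n, p)` that are equal or are joined with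
nonzero probability. -/
noncomputable def activeDiff (p : ℕ → ℝ) (n : ℕ) : Finset ℤ :=
  insert 0 ((activeDist p n).image (fun d : ℕ => (d : ℤ)) ∪
    (activeDist p n).image (fun d : ℕ => -(d : ℤ)))

theorem card_activeDiff_le (p : ℕ → ℝ) (n : ℕ) :
    (activeDiff p n).card ≤ 2 * (activeDist p n).card + 1 := by
  have h1 := Finset.card_insert_le (0 : ℤ) ((activeDist p n).image (fun d : ℕ => (d : ℤ)) ∪
    (activeDist p n).image (fun d : ℕ => -(d : ℤ)))
  have h2 := Finset.card_union_le ((activeDist p n).image (fun d : ℕ => (d : ℤ)))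
    ((activeDist p n).image (fun d : ℕ => -(d : ℤ)))
  have h3 : ((activeDist p n).image (fun d : ℕ => (d : ℤ))).card ≤ _ := Finset.card_image_le
  have h4 : ((activeDist p n).image (fun d : ℕ => -(d : ℤ))).card ≤ _ := Finset.card_image_le
  unfold activeDiff
  omega

open Classical in
/-- The pairs of nonzero probability that meet the translate by `t` of the image of `e`. -/
noncomputable def copyBlock {V : Type} (p : ℕ → ℝ) (n : ℕ) (e : V → ℕ) (t : ℕ) :
    Finset (VertexPair n) :=
  Finset.univ.filter fun i => p i.dist ≠ 0 ∧ ∃ x, (i.1.1 : ℕ) = e x + t ∨ (i.1.2 : ℕ) = e x + t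

section copyBlock

variable {V : Type} {p : ℕ → ℝ} {n : ℕ} {e : V → ℕ} {t : ℕ}

theorem mem_copyBlock {i : VertexPair n} : i ∈ copyBlock p n e t ↔
    p i.dist ≠ 0 ∧ ∃ x, (i.1.1 : ℕ) = e x + t ∨ (i.1.2 : ℕ) = e x + t := by
  simp [copyBlock]

theorem VertexPair.dist_mem_activeDist {i : VertexPair n} (h : p i.dist ≠ 0) :
    i.dist ∈ activeDist p n := by
  have h1 : (i.1.1 : ℕ) < i.1.2 := i.2
  have h2 := i.1.2.2
  have h3 : i.dist = i.1.2 - i.1.1 := rfl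
  simp only [activeDist, Finset.mem_filter, Finset.mem_range]
  exact ⟨by omega, by omega, h⟩

theorem diff_mem_activeDiff {i : VertexPair n} (h : p i.dist ≠ 0) {v w : ℕ}
    (hv : (i.1.1 : ℕ) = v ∨ (i.1.2 : ℕ) = v) (hw : (i.1.1 : ℕ) = w ∨ (i.1.2 : ℕ) = w) :
    (w : ℤ) - v ∈ activeDiff p n := by
  have hd := VertexPair.dist_mem_activeDist h
  have h1 : (i.1.1 : ℕ) < i.1.2 := i.2
  have h3 : i.dist = i.1.2 - i.1.1 := rfl
  simp only [activeDiff, Finset.mem_insert, Finset.mem_union, Finset.mem_image]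
  rcases hv with rfl | rfl <;> rcases hw with rfl | rfl
  · simp
  · exact Or.inr (Or.inl ⟨_, hd, by omega⟩)
  · exact Or.inr (Or.inr ⟨_, hd, by omega⟩)
  · simp

theorem card_copyBlock_le [Fintype V] (p : ℕ → ℝ) (n : ℕ) (e : V → ℕ) (t : ℕ) :
    (copyBlock p n e t).card ≤ Fintype.card V * (activeDiff p n).card := by
  classical
  have hinj : Function.Injective
      fun i : VertexPair n => (((i.1.1 : ℕ) : ℤ), ((i.1.2 : ℕ) : ℤ)) := by
    intro i j h
    simp only [Prod.mk.injEq, Nat.cast_inj] at h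
    exact Subtype.ext (Prod.ext (Fin.ext h.1) (Fin.ext h.2))
  rw [← Finset.card_univ, ← Finset.card_product, ← Finset.card_image_of_injective _ hinj]
  -- A pair is determined by an endpoint in the translate and the signed difference to the other.
  refine (Finset.card_le_card (t := ((Finset.univ : Finset V) ×ˢ activeDiff p n).image
    fun a => (min ((e a.1 + t : ℕ) : ℤ) ((e a.1 + t : ℕ) + a.2),
      max ((e a.1 + t : ℕ) : ℤ) ((e a.1 + t : ℕ) + a.2))) ?_).trans Finset.card_image_le
  intro a ha
  obtain ⟨i, hi, rfl⟩ := Finset.mem_image.1 ha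
  obtain ⟨hp, x, hx⟩ := mem_copyBlock.1 hi
  have h1 : (i.1.1 : ℕ) < i.1.2 := i.2
  rw [Finset.mem_image]
  rcases hx with hx | hx
  · refine ⟨(x, _), Finset.mem_product.2 ⟨Finset.mem_univ _,
      diff_mem_activeDiff hp (Or.inl rfl) (Or.inr rfl)⟩, ?_⟩
    simp only [← hx, Prod.mk.injEq]
    omega
  · refine ⟨(x, _), Finset.mem_product.2 ⟨Finset.mem_univ _,
      diff_mem_activeDiff hp (Or.inr rfl) (Or.inl rfl)⟩, ?_⟩
    simp only [← hx, Prod.mk.injEq]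
    omega

/-- Among the first `N` translates there are many with pairwise disjoint blocks. -/
theorem exists_disjoint_copyBlocks [Fintype V] (p : ℕ → ℝ) (n : ℕ) (e : V → ℕ) (N : ℕ) :
    ∃ T ⊆ Finset.range N, (T : Set ℕ).PairwiseDisjoint (copyBlock p n e) ∧
      N ≤ T.card * (1 + Fintype.card V ^ 2 * (activeDiff p n).card) := by
  classical
  obtain ⟨T, hTN, hT, hmax⟩ := exists_maximal_pairwiseDisjoint (Finset.range N) (copyBlock p n e)
  refine ⟨T, hTN, hT, ?_⟩
  have hsub : (Finset.range N).image (fun t : ℕ => (t : ℤ)) ⊆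
      T.image (fun t : ℕ => (t : ℤ)) ∪
        (T ×ˢ ((Finset.univ : Finset (V × V)) ×ˢ activeDiff p n)).image
          fun a => (a.1 : ℤ) + e a.2.1.2 - e a.2.1.1 - a.2.2 := by
    intro z hz
    obtain ⟨t, ht, rfl⟩ := Finset.mem_image.1 hz
    by_cases htT : t ∈ T
    · exact Finset.mem_union_left _ (Finset.mem_image_of_mem _ htT)
    · obtain ⟨t', ht', hdis⟩ := hmax t ht htT
      obtain ⟨i, hi, hi'⟩ := Finset.not_disjoint_iff.1 hdis
      obtain ⟨hp, x, hx⟩ := mem_copyBlock.1 hi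
      obtain ⟨-, y, hy⟩ := mem_copyBlock.1 hi'
      refine Finset.mem_union_right _ (Finset.mem_image.2 ⟨(t', (x, y), _),
        Finset.mem_product.2 ⟨ht', Finset.mem_product.2 ⟨Finset.mem_univ _,
          diff_mem_activeDiff hp hx hy⟩⟩, ?_⟩)
      push_cast
      ring
  have h1 := Finset.card_le_card hsub
  rw [Finset.card_image_of_injective _ Nat.cast_injective, Finset.card_range] at h1
  have h2 : N ≤ _ := h1.trans ((Finset.card_union_le _ _).trans
    (add_le_add Finset.card_image_le Finset.card_image_le))
  rw [Finset.card_product, Finset.card_product, Finset.card_univ, Fintype.card_prod] at h2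
  calc N ≤ _ := h2
    _ = _ := by ring

end copyBlock

open Classical in
/-- The probability that no translate of a placed graph `H` is an isolated copy decays exponentially
in the number of translates with disjoint blocks. Here `γ` bounds from below the probability of each
allowed behaviour of each relevant pair. -/
theorem exists_sum_graphWeight_no_copy_le {V : Type} [Fintype V] {p : ℕ → ℝ}
    (hp : ∀ d, 1 ≤ d → 0 ≤ p d ∧ p d ≤ 1) {H : SimpleGraph V} {e : V → ℕ} {M n : ℕ}
    (hM : ∀ x, e x < M) {γ : ℝ} (hγ : 0 < γ)
    (hγ1 : γ ≤ 1) (hγp : ∀ d ∈ activeDist p n, γ ≤ p d ∧ γ ≤ 1 - p d) :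
    ∃ N : ℕ, n - M ≤ N * (1 + Fintype.card V ^ 2 * (activeDiff p n).card) ∧
      ∑ G : SimpleGraph (Fin n) with
          ¬ ∃ t, IsIsolatedCopy p H e G t,
        graphWeight p n G ≤
      (1 - γ ^ (Fintype.card V * (activeDiff p n).card)) ^ N := by
  obtain ⟨T, hTN, hT, hcard⟩ := exists_disjoint_copyBlocks p n e (n - M)
  refine ⟨T.card, hcard, ?_⟩
  let pat : ℕ → VertexPair n → Bool := fun t i => decide (IsCopyEdge H e t i.1.1 i.1.2)
  have hle : ∀ t ∈ T, γ ^ (Fintype.card V * (activeDiff p n).card) ≤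
      ∏ i ∈ copyBlock p n e t, pairProb p i (pat t i) := by
    intro t _
    calc γ ^ (Fintype.card V * (activeDiff p n).card) ≤ γ ^ (copyBlock p n e t).card :=
          pow_le_pow_of_le_one hγ.le hγ1 (card_copyBlock_le p n e t)
      _ = ∏ i ∈ copyBlock p n e t, γ := (Finset.prod_const _).symm
      _ ≤ _ := by
        refine Finset.prod_le_prod (fun _ _ => hγ.le) fun i hi => ?_
        have := hγp _ (VertexPair.dist_mem_activeDist (mem_copyBlock.1 hi).1)
        unfold pairProb
        split_ifs
        exacts [this.1, this.2]
  have hpair : ∀ (i : VertexPair n) b, 0 ≤ pairProb p i b ∧ pairProb p i b ≤ 1 := by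
    intro i b
    have h : (i.1.1 : ℕ) < i.1.2 := i.2
    have := hp i.dist (by unfold VertexPair.dist; omega)
    unfold pairProb
    split_ifs <;> constructor <;> linarith
  calc _ ≤ ∑ G : SimpleGraph (Fin n) with
            ∀ t ∈ T, ¬ ∀ i ∈ copyBlock p n e t, edgeIndicator G i = pat t i,
          graphWeight p n G := by
        refine Finset.sum_le_sum_of_subset_of_nonneg (fun G hG => ?_)
          fun G _ _ => graphWeight_nonneg hp n G
        simp only [Finset.mem_filter, Finset.mem_univ, true_and] at hG ⊢
        intro t ht hcopy
        refine hG ⟨t, fun x => ?_, fun v w hvw hne hx => ?_⟩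
        · have h1 := hM x
          have h2 := Finset.mem_range.1 (hTN ht)
          omega
        · have := hcopy ⟨(v, w), hvw⟩ (mem_copyBlock.2 ⟨hne, hx⟩)
          simpa [pat, edgeIndicator] using this
    _ = ∏ t ∈ T, (1 - ∏ i ∈ copyBlock p n e t, pairProb p i (pat t i)) :=
        sum_graphWeight_avoid p n T _ hT pat
    _ ≤ ∏ t ∈ T, (1 - γ ^ (Fintype.card V * (activeDiff p n).card)) := by
        refine Finset.prod_le_prod (fun t _ => ?_) fun t ht => sub_le_sub_left (hle t ht) 1
        rw [sub_nonneg]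
        exact Finset.prod_le_one (fun i _ => (hpair i _).1) fun i _ => (hpair i _).2
    _ = _ := Finset.prod_const _

/-- The growth condition behind the zero-one law. Let `κ n` bound the number of distances below `n`
that occur with nonzero probability, and let `γ n` bound from below the probabilities of presence
and absence of edges of these distances. If `n` outgrows every fixed power of the reciprocal of
`γ n ^ (2 κ n + 1) / (2 κ n + 1)`, then every realizable graph appears asymptotically almost
surely as an isolated copy, and the zero-one law follows by absorption. -/
theorem zeroOneLaw_of_growth {p : ℕ → ℝ} (hp : ∀ d, 1 ≤ d → 0 ≤ p d ∧ p d ≤ 1) (γ : ℕ → ℝ)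
    (κ : ℕ → ℕ) (hγ : ∀ n, 0 < γ n ∧ γ n ≤ 1)
    (hγp : ∀ n, ∀ d ∈ activeDist p n, γ n ≤ p d ∧ γ n ≤ 1 - p d)
    (hκ : ∀ n, (activeDist p n).card ≤ κ n)
    (hgrowth : ∀ s : ℕ, Tendsto
      (fun n : ℕ => (n : ℝ) * (γ n ^ (2 * κ n + 1) / (2 * κ n + 1 : ℕ)) ^ s) atTop atTop)
    (ψ : FirstOrder.Language.graph.Sentence) : ZeroOneLaw p ψ := by
  classical
  obtain ⟨m, hm⟩ := exists_backForth_graphSatisfies ψ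
  obtain ⟨V, H, ⟨_, e, he⟩, hH⟩ := Placeable.exists_absorbing p m
  have : Fintype V := Fintype.ofFinite V
  obtain ⟨M, hM⟩ := Placeable.exists_bound e
  set s := Fintype.card V with hs
  -- The probability that no isolated copy of the absorbing graph `H` occurs.
  let bad : ℕ → ℝ := fun n => ∑ G : SimpleGraph (Fin n) with
    ¬ ∃ t, IsIsolatedCopy p H e G t,
    graphWeight p n G
  have hbad0 : ∀ n, 0 ≤ bad n := fun n =>
    Finset.sum_nonneg fun G _ => graphWeight_nonneg hp n G
  have hbad : Tendsto bad atTop (𝓝 0) := by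
    have hlim : Tendsto (fun n : ℕ => Real.exp (-((n : ℝ) *
        (γ n ^ (2 * κ n + 1) / (2 * κ n + 1 : ℕ)) ^ (s + 1) / (2 * (1 + s ^ 2))))) atTop (𝓝 0) :=
      Real.tendsto_exp_neg_atTop_nhds_zero.comp
        ((hgrowth (s + 1)).atTop_div_const (by positivity))
    refine tendsto_of_tendsto_of_tendsto_of_le_of_le' tendsto_const_nhds hlim
      (Eventually.of_forall hbad0) ?_
    filter_upwards [eventually_ge_atTop (2 * M)] with n hn
    obtain ⟨N, hN, hle⟩ := exists_sum_graphWeight_no_copy_le (H := H) hp hM (hγ n).1 (hγ n).2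
      (hγp n)
    refine hle.trans ?_
    have hΔ : (activeDiff p n).card ≤ 2 * κ n + 1 :=
      (card_activeDiff_le p n).trans (by have := hκ n; omega)
    set b := 2 * κ n + 1 with hb
    have hb1 : (1 : ℝ) ≤ (b : ℕ) := by exact_mod_cast (by omega : 1 ≤ b)
    set c := γ n ^ b with hc
    have hc0 : 0 < c := pow_pos (hγ n).1 _
    have hc1 : c ≤ 1 := pow_le_one₀ (hγ n).1.le (hγ n).2
    have hδ : c ^ s ≤ γ n ^ (s * (activeDiff p n).card) := by
      rw [hc, ← pow_mul, mul_comm b s]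
      exact pow_le_pow_of_le_one (hγ n).1.le (hγ n).2 (Nat.mul_le_mul_left _ hΔ)
    have hδ1 : γ n ^ (s * (activeDiff p n).card) ≤ 1 := pow_le_one₀ (hγ n).1.le (hγ n).2
    have hNn : (n : ℝ) / 2 ≤ N * ((1 + s ^ 2) * b) := by
      have h1 : n ≤ 2 * (N * ((1 + s ^ 2) * b)) := by
        have h2 : N * (1 + s ^ 2 * (activeDiff p n).card) ≤ N * ((1 + s ^ 2) * b) := by
          refine Nat.mul_le_mul_left _ ?_
          have := Nat.mul_le_mul_left (s ^ 2) hΔ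
          rw [add_mul, one_mul]
          omega
        have h3 := hN.trans h2
        omega
      have h3 : (n : ℝ) ≤ 2 * (N * ((1 + s ^ 2) * b)) := by exact_mod_cast h1
      linarith
    calc (1 - γ n ^ (s * (activeDiff p n).card)) ^ N ≤ Real.exp (-c ^ s) ^ N := by
          refine pow_le_pow_left₀ (by linarith) ?_ N
          have := Real.add_one_le_exp (-c ^ s)
          linarith
      _ = Real.exp (-(N * c ^ s)) := by rw [← Real.exp_nat_mul]; ring_nf
      _ ≤ _ := by
        refine Real.exp_le_exp.2 (neg_le_neg ?_)
        have hcs : (c / b) ^ (s + 1) ≤ c ^ s / b := by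
          rw [div_pow]
          refine div_le_div₀ (by positivity) ?_ (by positivity) ?_
          · exact pow_le_pow_of_le_one hc0.le hc1 (Nat.le_succ s)
          · exact le_self_pow₀ hb1 (Nat.succ_ne_zero s)
        rw [div_le_iff₀ (by positivity)]
        calc (n : ℝ) * (c / b) ^ (s + 1) ≤ n * (c ^ s / b) := by gcongr
          _ = (n / 2) * (2 * (c ^ s / b)) := by ring
          _ ≤ (N * ((1 + s ^ 2) * b)) * (2 * (c ^ s / b)) := by gcongr
          _ = _ := by field_simp
  -- Apart from the bad event, `G(n, p)` satisfies `ψ` exactly when `H` does.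
  have hgood : ∀ n (G : SimpleGraph (Fin n)), graphWeight p n G ≠ 0 →
      ¬ (GraphSatisfies G ψ ↔ GraphSatisfies H ψ) →
      ¬ ∃ t, IsIsolatedCopy p H e G t := by
    rintro n G hG hne ⟨t, hcopy⟩
    exact hne (hm _ _ G H (backForth_of_copy he hH hG hcopy))
  have hsum : ∀ n, ∑ G : SimpleGraph (Fin n) with ¬ (GraphSatisfies G ψ ↔ GraphSatisfies H ψ),
      graphWeight p n G ≤ bad n := by
    intro n
    rw [← Finset.sum_filter_ne_zero]
    refine Finset.sum_le_sum_of_subset_of_nonneg (fun G hG => ?_)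
      fun G _ _ => graphWeight_nonneg hp n G
    simp only [Finset.mem_filter, Finset.mem_univ, true_and] at hG ⊢
    exact hgood n G hG.2 hG.1
  by_cases hψ : GraphSatisfies H ψ
  · right
    have hlow : ∀ n, 1 - bad n ≤ sentenceProb p n ψ := by
      intro n
      have h1 := hsum n
      have h2 := Finset.sum_filter_add_sum_filter_not (Finset.univ : Finset (SimpleGraph (Fin n)))
        (fun G => GraphSatisfies G ψ) (graphWeight p n)
      rw [sum_graphWeight] at h2
      simp only [hψ, iff_true] at h1
      unfold sentenceProb
      linarith
    have hup : ∀ n, sentenceProb p n ψ ≤ 1 := by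
      intro n
      rw [← sum_graphWeight p n]
      exact Finset.sum_le_sum_of_subset_of_nonneg (Finset.filter_subset _ _)
        fun G _ _ => graphWeight_nonneg hp n G
    refine tendsto_of_tendsto_of_tendsto_of_le_of_le ?_ tendsto_const_nhds hlow hup
    simpa using hbad.const_sub 1
  · left
    refine tendsto_of_tendsto_of_tendsto_of_le_of_le tendsto_const_nhds hbad
      (fun n => Finset.sum_nonneg fun G _ => graphWeight_nonneg hp n G) fun n => ?_
    have h1 := hsum n
    simp only [hψ, iff_false, not_not] at h1
    exact h1

/-! ### Diluted sequences -/

/-- A lower bound, positive when `0 ≤ x < 1`, for the probabilities of the possible states of a pair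
joined with probability `x`. -/
noncomputable def stateBound (x : ℝ) : ℝ := if x = 0 then 1 else min x (1 - x)

theorem stateBound_pos {x : ℝ} (h0 : 0 ≤ x) (h1 : x < 1) : 0 < stateBound x := by
  unfold stateBound
  split_ifs with h
  · exact one_pos
  · exact lt_min (lt_of_le_of_ne h0 (Ne.symm h)) (by linarith)

theorem stateBound_le_one {x : ℝ} (h1 : x < 1) : stateBound x ≤ 1 := by
  unfold stateBound
  split_ifs
  · exact le_rfl
  · exact (min_le_left _ _).trans h1.le

/-- A lower bound for the probabilities of the possible states of a pair whose distance is the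
position of one of the first `k` terms of `a`. -/
noncomputable def prefixBound (a : ℕ → ℝ) (k : ℕ) : ℝ := ∏ i ∈ Finset.Icc 1 k, stateBound (a i)

/-- The rate in the growth condition when the first `k` terms of `a` are in use: `n` times any fixed
power of it has to tend to infinity. -/
noncomputable def prefixRate (a : ℕ → ℝ) (k : ℕ) : ℝ :=
  prefixBound a k ^ (2 * k + 1) / (2 * k + 1 : ℕ)

theorem prefixBound_pos {a : ℕ → ℝ} (ha : ∀ i, 1 ≤ i → 0 ≤ a i ∧ a i < 1) (k : ℕ) :
    0 < prefixBound a k :=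
  Finset.prod_pos fun i hi =>
    stateBound_pos (ha i (Finset.mem_Icc.1 hi).1).1 (ha i (Finset.mem_Icc.1 hi).1).2

theorem prefixBound_le_stateBound {a : ℕ → ℝ} (ha : ∀ i, 1 ≤ i → 0 ≤ a i ∧ a i < 1) {i k : ℕ}
    (hi : i ∈ Finset.Icc 1 k) : prefixBound a k ≤ stateBound (a i) := by
  have h0 : ∀ j ∈ Finset.Icc 1 k, 0 ≤ stateBound (a j) := fun j hj =>
    (stateBound_pos (ha j (Finset.mem_Icc.1 hj).1).1 (ha j (Finset.mem_Icc.1 hj).1).2).le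
  have h1 : ∀ j ∈ Finset.Icc 1 k, stateBound (a j) ≤ 1 := fun j hj =>
    stateBound_le_one (ha j (Finset.mem_Icc.1 hj).1).2
  unfold prefixBound
  rw [← Finset.mul_prod_erase _ _ hi]
  exact mul_le_of_le_one_right (h0 i hi) (Finset.prod_le_one
    (fun j hj => h0 j (Finset.mem_of_mem_erase hj)) fun j hj => h1 j (Finset.mem_of_mem_erase hj))

theorem prefixBound_le_one {a : ℕ → ℝ} (ha : ∀ i, 1 ≤ i → 0 ≤ a i ∧ a i < 1) (k : ℕ) :
    prefixBound a k ≤ 1 :=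
  Finset.prod_le_one
    (fun j hj =>
      (stateBound_pos (ha j (Finset.mem_Icc.1 hj).1).1 (ha j (Finset.mem_Icc.1 hj).1).2).le)
    fun j hj => stateBound_le_one (ha j (Finset.mem_Icc.1 hj).1).2

theorem prefixRate_pos {a : ℕ → ℝ} (ha : ∀ i, 1 ≤ i → 0 ≤ a i ∧ a i < 1) (k : ℕ) :
    0 < prefixRate a k :=
  div_pos (pow_pos (prefixBound_pos ha k) _) (by positivity)

theorem prefixRate_le_one {a : ℕ → ℝ} (ha : ∀ i, 1 ≤ i → 0 ≤ a i ∧ a i < 1) (k : ℕ) :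
    prefixRate a k ≤ 1 :=
  div_le_one_of_le₀ ((pow_le_one₀ (prefixBound_pos ha k).le (prefixBound_le_one ha k)).trans
    (by exact_mod_cast Nat.le_add_left 1 (2 * k))) (by positivity)

theorem dilutedPos_strictMono (g : ℕ → ℕ) : StrictMono (dilutedPos g) := by
  refine strictMono_nat_of_lt_succ fun i => ?_
  have : ∑ j ∈ Finset.Ico 1 i, g j ≤ ∑ j ∈ Finset.Ico 1 (i + 1), g j :=
    Finset.sum_le_sum_of_subset (Finset.Ico_subset_Ico_right (Nat.le_succ i))
  unfold dilutedPos
  omega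

theorem lt_dilutedPos_succ (g : ℕ → ℕ) {i : ℕ} (hi : 1 ≤ i) : g i < dilutedPos g (i + 1) := by
  have : g i ≤ ∑ j ∈ Finset.Ico 1 (i + 1), g j :=
    Finset.single_le_sum (f := g) (fun _ _ => Nat.zero_le _)
      (Finset.mem_Ico.2 ⟨hi, Nat.lt_succ_self i⟩)
  unfold dilutedPos
  omega

/-- The number of terms `a i` whose positions in the diluted sequence are less than `n`. -/
def usedTerms (g : ℕ → ℕ) (n : ℕ) : ℕ := Nat.findGreatest (fun k => dilutedPos g k < n) n

theorem le_usedTerms {g : ℕ → ℕ} {i n : ℕ} (h : dilutedPos g i < n) : i ≤ usedTerms g n :=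
  Nat.le_findGreatest (((dilutedPos_strictMono g).le_apply).trans h.le) h

theorem dilutedPos_usedTerms_lt (g : ℕ → ℕ) {n : ℕ} (h : usedTerms g n ≠ 0) :
    dilutedPos g (usedTerms g n) < n :=
  Nat.findGreatest_of_ne_zero (P := fun k => dilutedPos g k < n) (n := n) rfl h

theorem tendsto_usedTerms (g : ℕ → ℕ) : Tendsto (usedTerms g) atTop atTop :=
  tendsto_atTop.2 fun k => by
    filter_upwards [eventually_gt_atTop (dilutedPos g k)] with n hn using le_usedTerms hn

theorem activeDist_subset {a p : ℕ → ℝ} {g : ℕ → ℕ} (h : IsDilution a g p) (n : ℕ) :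
    activeDist p n ⊆ (Finset.Icc 1 (usedTerms g n)).image (dilutedPos g) := by
  intro d hd
  simp only [activeDist, Finset.mem_filter, Finset.mem_range] at hd
  obtain ⟨hdn, hd1, hpd⟩ := hd
  have : ∃ i, 1 ≤ i ∧ d = dilutedPos g i := by
    by_contra! hne
    exact hpd (h.2 d hd1 hne)
  obtain ⟨i, hi, rfl⟩ := this
  exact Finset.mem_image.2 ⟨i, Finset.mem_Icc.2 ⟨hi, le_usedTerms hdn⟩, rfl⟩

theorem mainTheorem2 (a : ℕ → ℝ) (ha : ∀ i, 1 ≤ i → 0 ≤ a i ∧ a i < 1) :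
    ∃ f : ℕ → ℕ, ∀ (g : ℕ → ℕ) (p : ℕ → ℝ),
      (∀ i, 1 ≤ i → f i < g i) → IsDilution a g p →
        ∀ ψ : FirstOrder.Language.graph.Sentence, ZeroOneLaw p ψ := by
  -- Once the `(i + 1)`-st term is in use, `n` exceeds `f i`; this makes `n` times the `(i + 1)`-st
  -- power of the rate for `i + 1` terms at least `i + 1`.
  refine ⟨fun i => ⌈((i + 1 : ℕ) : ℝ) / prefixRate a (i + 1) ^ (i + 1)⌉₊,
    fun g p hg hp => zeroOneLaw_of_growth ?_ (fun n => prefixBound a (usedTerms g n)) (usedTerms g)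
      (fun n => ⟨prefixBound_pos ha _, prefixBound_le_one ha _⟩) ?_ ?_ ?_⟩
  · intro d hd
    by_cases h : ∃ i, 1 ≤ i ∧ d = dilutedPos g i
    · obtain ⟨i, hi, rfl⟩ := h
      rw [hp.1 i hi]
      exact ⟨(ha i hi).1, (ha i hi).2.le⟩
    · rw [hp.2 d hd (fun i hi hd => h ⟨i, hi, hd⟩)]
      exact ⟨le_rfl, zero_le_one⟩
  · intro n d hd
    obtain ⟨i, hi, rfl⟩ := Finset.mem_image.1 (activeDist_subset hp n hd)
    have hne : a i ≠ 0 := by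
      rw [← hp.1 i (Finset.mem_Icc.1 hi).1]
      exact (Finset.mem_filter.1 hd).2.2
    have h := prefixBound_le_stateBound ha hi
    rw [stateBound, if_neg hne, le_min_iff] at h
    rwa [hp.1 i (Finset.mem_Icc.1 hi).1]
  · intro n
    refine (Finset.card_le_card (activeDist_subset hp n)).trans (Finset.card_image_le.trans ?_)
    simp
  · intro s
    refine tendsto_atTop_mono' atTop ?_
      (tendsto_natCast_atTop_atTop.comp (tendsto_usedTerms g) : Tendsto _ _ (atTop : Filter ℝ))
    filter_upwards [(tendsto_usedTerms g).eventually_ge_atTop (max 2 s)] with n hn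
    change _ ≤ (n : ℝ) * prefixRate a (usedTerms g n) ^ s
    have hpos := dilutedPos_usedTerms_lt g (n := n) (by omega)
    obtain ⟨i, hi⟩ : ∃ i, usedTerms g n = i + 1 := ⟨usedTerms g n - 1, by omega⟩
    simp only [Function.comp_apply]
    rw [hi] at hpos hn ⊢
    have hfi : ⌈((i + 1 : ℕ) : ℝ) / prefixRate a (i + 1) ^ (i + 1)⌉₊ ≤ n :=
      ((hg i (by omega)).trans ((lt_dilutedPos_succ g (by omega)).trans hpos)).le
    have h0 := prefixRate_pos ha (i + 1)
    calc ((i + 1 : ℕ) : ℝ) ≤ n * prefixRate a (i + 1) ^ (i + 1) :=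
          (div_le_iff₀ (pow_pos h0 _)).1 (Nat.ceil_le.1 hfi)
      _ ≤ n * prefixRate a (i + 1) ^ s := by
          refine mul_le_mul_of_nonneg_left ?_ (Nat.cast_nonneg n)
          exact pow_le_pow_of_le_one h0.le (prefixRate_le_one ha _) (by omega)
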